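/- Let $n>s\ge 1$ be integers and let $\boldsymbol r=(r_0,\dots,r_s)\in\mathbb R^{s+1}$ be such that $g_{\boldsymbol r}(x)=r_0+r_1x+\cdots+r_sx^s$ is a separable polynomial of degree $s$. For a nonzero real polynomial $f$ let $N_f$ be the number of its distinct real roots, and put $\gamma=N_{g_{\boldsymbol r}}$. Put $$f_{\boldsymbol r}(t;x)=x^n+t\,g_{\boldsymbol r}(x)\in\mathbb R[t][x].$$ For polynomials $f_1,f_2$ in $x$ of degree at most $n$ over a commutative ring, the Bezoutian $M_n(f_1,f_2)=(\alpha_{ij})_{1\le i,j\le n}$ is the matrix defined by $$\frac{f_1(x)f_2(y)-f_1(y)f_2(x)}{x-y}=\sum_{i,j=1}^n\alpha_{ij}\,x^{n-i}y^{n-j}.$$ Let $$P_{\boldsymbol r}(t)=\det M_n\bigl(f_{\boldsymbol r}(t;x),f_{\boldsymbol r}'(t;x)\bigr)\in\mathbb R[t],$$ where $f_{\boldsymbol r}'(t;x)$ is the derivative of $f_{\boldsymbol r}(t;x)$ with respect to $x$. Then $P_{\boldsymbol r}$ has a largest real root $\alpha_{\boldsymbol r}=\max\{\alpha\in\mathbb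 R\mid P_{\boldsymbol r}(\alpha)=0\}$, and for every real number $\xi>\alpha_{\boldsymbol r}$, $$N_{f_{\boldsymbol r}(\xi;x)}=\begin{cases}\gamma+1 & \text{if } n-s \text{ is odd},\\ \gamma & \text{if } n-s \text{ is even and } r_s>0,\\ \gamma+2 & \text{if } n-s \text{ is even and } r_s<0.\end{cases}$$ -/

import Mathlib

open Polynomial

namespace BezoutianRealRoots

/-- The number `N_f` of distinct real roots of a real polynomial `f` (used for `f ≠ 0` only). -/
noncomputable def numRealRoots (f : ℝ[X]) : ℕ := {x : ℝ | f.IsRoot x}.ncard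

/-- The polynomial `f₁(x) f₂(y) - f₁(y) f₂(x)` in `R[x][y]`: the inner variable, `C X`, is `x`,
and the outer variable, `X`, is `y`. -/
noncomputable def bezoutNumerator {R : Type*} [CommRing R] (f₁ f₂ : R[X]) : R[X][X] :=
  C f₁ * f₂.map C - f₁.map C * C f₂

/-- `B(f₁, f₂) = (f₁(x) f₂(y) - f₁(y) f₂(x)) / (x - y)`, as a polynomial in `R[x][y]`
(division by the monic `y - x`, with the sign changed). -/
noncomputable def bezoutPoly {R : Type*} [CommRing R] (f₁ f₂ : R[X]) : R[X][X] :=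
  -(bezoutNumerator f₁ f₂ /ₘ (X - C X))

/-- The division defining `bezoutPoly` is exact. -/
theorem sub_mul_bezoutPoly {R : Type*} [CommRing R] (f₁ f₂ : R[X]) :
    (C X - X) * bezoutPoly f₁ f₂ = bezoutNumerator f₁ f₂ := by
  have h : (bezoutNumerator f₁ f₂).IsRoot X := by
    simp [bezoutNumerator, IsRoot, eval_map, eval₂_C_X]
  have h' := mul_divByMonic_eq_iff_isRoot.mpr h
  rw [bezoutPoly]
  linear_combination h'

/-- The Bezoutian `M_n(f₁, f₂)`: with rows and columns counted from `0`, its `(i, j)` entry is the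
coefficient of `x ^ (n - 1 - i) * y ^ (n - 1 - j)` in `B(f₁, f₂)`. -/
noncomputable def bezoutian {R : Type*} [CommRing R] (n : ℕ) (f₁ f₂ : R[X]) :
    Matrix (Fin n) (Fin n) R :=
  Matrix.of fun i j => ((bezoutPoly f₁ f₂).coeff (n - 1 - (j : ℕ))).coeff (n - 1 - (i : ℕ))

/-- `g_r(x) = r₀ + r₁ x + ⋯ + r_s x ^ s`. -/
noncomputable def gPoly {s : ℕ} (r : Fin (s + 1) → ℝ) : ℝ[X] :=
  ∑ k : Fin (s + 1), C (r k) * X ^ (k : ℕ)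

/-- `f_r(t; x) = x ^ n + t * g_r(x)`, as a polynomial in `x` over `ℝ[t]`. -/
noncomputable def fPoly {s : ℕ} (n : ℕ) (r : Fin (s + 1) → ℝ) : ℝ[X][X] :=
  X ^ n + C X * (gPoly r).map C

/-- The specialization `f_r(ξ; x)` of `f_r(t; x)` at a real number `t = ξ`. -/
noncomputable def fPolyAt {s : ℕ} (n : ℕ) (r : Fin (s + 1) → ℝ) (ξ : ℝ) : ℝ[X] :=
  (fPoly n r).map (evalRingHom ξ)

/-- `P_r(t) = det M_n(f_r(t; x), f_r'(t; x))`, where `'` is the derivative with respect to `x`.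
The entries of the matrix, and hence the determinant, lie in `ℝ[t]`. -/
noncomputable def PPoly {s : ℕ} (n : ℕ) (r : Fin (s + 1) → ℝ) : ℝ[X] :=
  (bezoutian n (fPoly n r) (derivative (fPoly n r))).det

end BezoutianRealRoots

open BezoutianRealRoots

/-! For `ξ ≠ 0` put `ε = ξ⁻¹`: up to the factor `ξ`, the polynomial `f_r(ξ; x)` is `ε x ^ n + g(x)`.
The Bezoutian of `f` and `f'` is singular whenever they share a real root, so for `ξ > α` every real
root is simple. Simple roots move continuously, and none escapes to infinity while `ε` stays near a
positive value, so the number of roots is constant in `ε` on `0 < ε < 1/α`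
(`eventually_ncard_roots_eq_of_pos`).

It is computed as `ε → 0⁺` (`eventually_ncard_roots_small`): each real root of `g` continues to one
root, one more comes in from `+∞` exactly when `r_s < 0`, and one from `-∞` exactly when `(-1) ^ (n
- s) * r_s < 0`.

The root `α` exists because `P_r(0) = 0` and `P_r` has finitely many real zeros
(`finite_setOf_eval_PPoly_eq_zero`): a nonzero one yields a complex double root `z` of `f`, which is
a root of `n g - x g'` and determines `ξ = -z ^ n / g(z)`. -/

namespace BezoutianRealRoots

/-! ### Singularity of the Bezoutian and common roots. -/

section Bezoutian

variable {R : Type*} [CommRing R]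

theorem coeff_iterate_divX (p : R[X]) (k i : ℕ) : (divX^[k] p).coeff i = p.coeff (i + k) := by
  induction k generalizing i with
  | zero => simp
  | succ k ih => rw [Function.iterate_succ_apply', coeff_divX, ih]; congr 1; omega

theorem iterate_divX_eq_X_mul_add (p : R[X]) (k : ℕ) :
    divX^[k] p = X * divX^[k + 1] p + C (p.coeff k) := by
  have h := X_mul_divX_add (divX^[k] p)
  rw [coeff_iterate_divX, zero_add] at h
  rw [Function.iterate_succ_apply', h]

theorem iterate_divX_eq_zero {p : R[X]} {k : ℕ} (h : p.natDegree < k) : divX^[k] p = 0 := by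
  ext i
  rw [coeff_iterate_divX, coeff_zero, coeff_eq_zero_of_natDegree_lt (by omega)]

theorem natDegree_sub_iterate_divX_mul_X_pow_le (p : R[X]) (k : ℕ) :
    (p - divX^[k + 1] p * X ^ (k + 1)).natDegree ≤ k := by
  rw [natDegree_le_iff_coeff_eq_zero]
  intro m hm
  obtain ⟨j, rfl⟩ := Nat.exists_eq_add_of_lt hm
  rw [show k + j + 1 = j + (k + 1) by omega, coeff_sub, coeff_mul_X_pow, coeff_iterate_divX, sub_self]

/-- Comparing coefficients of `y ^ (k + 1)` in `(x - y) B = f₁(x) f₂(y) - f₁(y) f₂(x)` expresses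
coefficient `k` through coefficient `k + 1`. Both sides vanish for large `k`, so the induction
descends. -/
theorem coeff_bezoutPoly (f₁ f₂ : R[X]) (k : ℕ) :
    (bezoutPoly f₁ f₂).coeff k = f₂ * divX^[k + 1] f₁ - f₁ * divX^[k + 1] f₂ := by
  have hrec (k : ℕ) : (bezoutPoly f₁ f₂).coeff k = X * (bezoutPoly f₁ f₂).coeff (k + 1)
      - (f₁ * C (f₂.coeff (k + 1)) - C (f₁.coeff (k + 1)) * f₂) := by
    have h := congrArg (fun p : R[X][X] => p.coeff (k + 1)) (sub_mul_bezoutPoly f₁ f₂)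
    simp only [bezoutNumerator, sub_mul, coeff_sub, coeff_C_mul, coeff_X_mul, coeff_map,
      coeff_mul_C] at h
    linear_combination -h
  obtain ⟨N, hN⟩ : ∃ N, (bezoutPoly f₁ f₂).natDegree < N ∧ f₁.natDegree < N ∧ f₂.natDegree < N :=
    ⟨(bezoutPoly f₁ f₂).natDegree + f₁.natDegree + f₂.natDegree + 1, by omega⟩
  induction hj : N - k generalizing k with
  | zero =>
    rw [coeff_eq_zero_of_natDegree_lt (by omega), iterate_divX_eq_zero (by omega),
      iterate_divX_eq_zero (by omega)]
    simp
  | succ j ih =>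
    rw [hrec, ih (k + 1) (by omega), iterate_divX_eq_X_mul_add f₁ (k + 1),
      iterate_divX_eq_X_mul_add f₂ (k + 1)]
    ring

theorem coeff_coeff_bezoutPoly_eq_zero {f₁ f₂ : R[X]} {n : ℕ} (h₁ : f₁.natDegree ≤ n)
    (h₂ : f₂.natDegree ≤ n) (k : ℕ) {m : ℕ} (hm : n ≤ m) :
    ((bezoutPoly f₁ f₂).coeff k).coeff m = 0 := by
  -- The parenthesized factors are truncations of degree at most `k`, so the right side has degree
  -- at most `n + k`.
  have key : (bezoutPoly f₁ f₂).coeff k * X ^ (k + 1) =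
      f₁ * (f₂ - divX^[k + 1] f₂ * X ^ (k + 1)) - f₂ * (f₁ - divX^[k + 1] f₁ * X ^ (k + 1)) := by
    rw [coeff_bezoutPoly]; ring
  rw [← coeff_mul_X_pow _ (k + 1), key, coeff_sub,
    coeff_eq_zero_of_natDegree_lt, coeff_eq_zero_of_natDegree_lt, sub_zero]
  · have := natDegree_sub_iterate_divX_mul_X_pow_le f₁ k
    exact natDegree_mul_le.trans_lt (by omega)
  · have := natDegree_sub_iterate_divX_mul_X_pow_le f₂ k
    exact natDegree_mul_le.trans_lt (by omega)

theorem coeff_bezoutPoly_eq_zero {f₁ f₂ : R[X]} {n : ℕ} (h₁ : f₁.natDegree ≤ n)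
    (h₂ : f₂.natDegree ≤ n) {k : ℕ} (hk : n ≤ k) : (bezoutPoly f₁ f₂).coeff k = 0 := by
  rw [coeff_bezoutPoly, iterate_divX_eq_zero (by omega), iterate_divX_eq_zero (by omega)]
  simp

theorem bezoutPoly_map {S : Type*} [CommRing S] (φ : R →+* S) (f₁ f₂ : R[X]) :
    bezoutPoly (f₁.map φ) (f₂.map φ) = (bezoutPoly f₁ f₂).map (mapRingHom φ) := by
  ext k i
  rw [coeff_map, coeff_bezoutPoly, coeff_bezoutPoly]
  have h (p : R[X]) : divX^[k + 1] (p.map φ) = (divX^[k + 1] p).map φ := by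
    ext i; simp [coeff_iterate_divX]
  simp [h]

theorem map_det_bezoutian {S : Type*} [CommRing S] (φ : R →+* S) (n : ℕ) (f₁ f₂ : R[X]) :
    φ (bezoutian n f₁ f₂).det = (bezoutian n (f₁.map φ) (f₂.map φ)).det := by
  rw [RingHom.map_det]
  congr 1
  ext i j
  simp [bezoutian, bezoutPoly_map]

/-- Since `(x - a) B(x, a) = 0`, the powers of `a` form a kernel vector; its last entry is `1`. -/
theorem det_bezoutian_eq_zero_of_isRoot [IsDomain R] {f₁ f₂ : R[X]} {n : ℕ} (hn : 0 < n)
    (h₁ : f₁.natDegree ≤ n) (h₂ : f₂.natDegree ≤ n) {a : R} (ha₁ : f₁.IsRoot a)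
    (ha₂ : f₂.IsRoot a) : (bezoutian n f₁ f₂).det = 0 := by
  refine Matrix.exists_mulVec_eq_zero_iff.mp ⟨fun j => a ^ (n - 1 - (j : ℕ)), ?_, ?_⟩
  · intro h
    have := congrFun h ⟨n - 1, by omega⟩
    simp at this
  · have hzero : (bezoutPoly f₁ f₂).eval (C a) = 0 := by
      have h := congrArg (eval (C a)) (sub_mul_bezoutPoly f₁ f₂)
      have hc (p : R[X]) : (p.map C).eval (C a) = C (p.eval a) := by
        rw [eval_map, eval₂_at_apply]
      simp only [bezoutNumerator, eval_mul, eval_sub, eval_C, eval_X, hc, ha₁.eq_zero, ha₂.eq_zero,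
        C_0, mul_zero, zero_mul, sub_zero] at h
      exact (mul_eq_zero.mp h).resolve_left (X_sub_C_ne_zero a)
    have hsum : (bezoutPoly f₁ f₂).eval (C a) =
        ∑ k ∈ Finset.range n, (bezoutPoly f₁ f₂).coeff k * C a ^ k := by
      refine eval_eq_sum_range' ?_ _
      refine lt_of_le_of_lt ((natDegree_le_iff_coeff_eq_zero (n := n - 1)).mpr fun m hm =>
        coeff_bezoutPoly_eq_zero h₁ h₂ (by omega)) (by omega)
    ext i
    rw [hzero, ← Finset.sum_range_reflect, Finset.sum_range] at hsum
    have h := congrArg (fun p : R[X] => p.coeff (n - 1 - (i : ℕ))) hsum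
    simp only [coeff_zero, finsetSum_coeff, ← C_pow, coeff_mul_C] at h
    simpa [Matrix.mulVec, dotProduct, bezoutian] using h.symm

/-- A kernel vector `c` gives `f₁ ∣ f₂ * D` with `D` of degree below `n`. Coprimality forces `D =
0`, and a triangular system then gives `c = 0`. -/
theorem det_bezoutian_ne_zero_of_isCoprime [IsDomain R] {f₁ f₂ : R[X]} {n : ℕ}
    (hmonic : f₁.Monic) (h₁ : f₁.natDegree = n) (h₂ : f₂.natDegree ≤ n) (hco : IsCoprime f₁ f₂) :
    (bezoutian n f₁ f₂).det ≠ 0 := by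
  intro hdet
  obtain ⟨c, hc, hMc⟩ := Matrix.exists_mulVec_eq_zero_iff.mpr hdet
  apply hc
  have hb : ∑ j : Fin n, (bezoutPoly f₁ f₂).coeff (n - 1 - (j : ℕ)) * C (c j) = 0 := by
    ext m
    rw [finsetSum_coeff]
    simp only [coeff_mul_C, coeff_zero]
    by_cases hm : n ≤ m
    · exact Finset.sum_eq_zero fun j _ => by
        rw [coeff_coeff_bezoutPoly_eq_zero h₁.le h₂ _ hm, zero_mul]
    · have h := congrFun hMc ⟨n - 1 - m, by omega⟩
      have hm' : n - 1 - (n - 1 - m) = m := by omega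
      simpa [Matrix.mulVec, dotProduct, bezoutian, hm'] using h
  set D : R[X] := ∑ j : Fin n, divX^[n - 1 - (j : ℕ) + 1] f₁ * C (c j) with hD
  have hcoeff (m : ℕ) : D.coeff m = ∑ j : Fin n, f₁.coeff (m + (n - 1 - (j : ℕ) + 1)) * c j := by
    simp [hD, coeff_iterate_divX, add_assoc]
  have hD0 : D = 0 := by
    have hdvd : f₁ ∣ f₂ * D := by
      refine ⟨∑ j : Fin n, divX^[n - 1 - (j : ℕ) + 1] f₂ * C (c j), ?_⟩
      rw [← sub_eq_zero, ← hb, hD, Finset.mul_sum, Finset.mul_sum, ← Finset.sum_sub_distrib]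
      refine Finset.sum_congr rfl fun j _ => ?_
      rw [coeff_bezoutPoly]; ring
    by_contra hne
    have hn : 0 < n := by
      rcases Nat.eq_zero_or_pos n with rfl | h
      · exact absurd (by simp [hD]) hne
      · exact h
    have hlt : D.natDegree < f₁.natDegree := by
      refine lt_of_le_of_lt ((natDegree_le_iff_coeff_eq_zero (n := n - 1)).mpr fun m hm => ?_)
        (by omega : n - 1 < f₁.natDegree)
      rw [hcoeff]
      exact Finset.sum_eq_zero fun j _ => by
        rw [coeff_eq_zero_of_natDegree_lt (by omega), zero_mul]
    exact hmonic.not_dvd_of_natDegree_lt hne hlt (hco.dvd_of_dvd_mul_left hdvd)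
  -- The coefficient of `x ^ j` in `D` is `c j` plus a combination of the `c i` with `i > j`, so the
  -- entries vanish from the last one backwards.
  have hc0 (d : ℕ) : ∀ j : Fin n, n - 1 - (j : ℕ) = d → c j = 0 := by
    induction d using Nat.strong_induction_on with
    | _ d ih =>
      intro j hj
      have h := hcoeff (j : ℕ)
      rw [hD0, coeff_zero, Finset.sum_eq_single j] at h
      · rw [show (j : ℕ) + (n - 1 - (j : ℕ) + 1) = f₁.natDegree by omega, coeff_natDegree,
          hmonic.leadingCoeff, one_mul] at h
        exact h.symm
      · intro i _ hij
        have hij' : (i : ℕ) ≠ j := fun h => hij (Fin.ext h)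
        rcases lt_or_gt_of_ne hij' with hlt | hlt
        · rw [coeff_eq_zero_of_natDegree_lt (by omega), zero_mul]
        · rw [ih (n - 1 - (i : ℕ)) (by omega) i rfl, mul_zero]
      · simp
  exact funext fun j => hc0 _ j rfl

end Bezoutian
end BezoutianRealRoots
namespace BezoutianRealRoots

/-! ### Counting real roots of `ε x ^ n + g(x)` as `ε` varies. -/

section Pencil

open Filter Topology

theorem exists_tendsto_eventually_root_iff (p q : ℝ[X]) {t₀ x₀ : ℝ}
    (h₀ : t₀ * p.eval x₀ + q.eval x₀ = 0)
    (h₁ : t₀ * p.derivative.eval x₀ + q.derivative.eval x₀ ≠ 0) :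
    ∃ φ : ℝ → ℝ, Tendsto φ (𝓝 t₀) (𝓝 x₀) ∧
      ∀ᶠ v : ℝ × ℝ in 𝓝 (t₀, x₀), v.1 * p.eval v.2 + q.eval v.2 = 0 ↔ φ v.1 = v.2 := by
  set F : ℝ × ℝ → ℝ := fun v => v.1 * p.eval v.2 + q.eval v.2 with hF
  have hcd : ContDiff ℝ 1 F := by
    have hp : ContDiff ℝ 1 fun x : ℝ => p.eval x := by
      simpa using p.contDiff_aeval (𝕜 := ℝ) 1
    have hq : ContDiff ℝ 1 fun x : ℝ => q.eval x := by
      simpa using q.contDiff_aeval (𝕜 := ℝ) 1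
    exact (contDiff_fst.mul (hp.comp contDiff_snd)).add (hq.comp contDiff_snd)
  have hstrict : HasStrictFDerivAt F (fderiv ℝ F (t₀, x₀)) (t₀, x₀) :=
    hcd.contDiffAt.hasStrictFDerivAt (by simp)
  have hval : (fderiv ℝ F (t₀, x₀)) (0, 1) =
      t₀ * p.derivative.eval x₀ + q.derivative.eval x₀ := by
    have hd : HasDerivAt (fun x : ℝ => ((t₀, x) : ℝ × ℝ)) (0, 1) x₀ :=
      (hasDerivAt_const x₀ t₀).prodMk (hasDerivAt_id x₀)
    have hd₁ : HasDerivAt (fun x : ℝ => F (t₀, x)) ((fderiv ℝ F (t₀, x₀)) (0, 1)) x₀ :=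
      hstrict.hasFDerivAt.comp_hasDerivAt x₀ hd
    exact hd₁.unique (((p.hasDerivAt x₀).const_mul t₀).add (q.hasDerivAt x₀))
  have hinv : (fderiv ℝ F (t₀, x₀) ∘L .inr ℝ ℝ ℝ).IsInvertible := by
    refine ⟨ContinuousLinearEquiv.unitsEquivAut ℝ (Units.mk0 _ h₁), ?_⟩
    ext
    simp [hval]
  refine ⟨hstrict.implicitFunctionOfProdDomain hinv,
    hstrict.tendsto_implicitFunctionOfProdDomain hinv, ?_⟩
  have h := hstrict.eventually_apply_eq_iff_implicitFunctionOfProdDomain hinv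
  rwa [show F (t₀, x₀) = 0 from h₀] at h

/-- By the implicit function theorem each root lies on a branch `φ x`. For `t` near `t₀` the
branches stay in `K`, remain distinct, and by compactness account for all roots in `K`. -/
theorem eventually_ncard_roots_eq (p q : ℝ[X]) {t₀ : ℝ} {K : Set ℝ} (hK : IsCompact K)
    (hfin : {x | x ∈ K ∧ t₀ * p.eval x + q.eval x = 0}.Finite)
    (hroot : ∀ x ∈ K, t₀ * p.eval x + q.eval x = 0 →
      K ∈ 𝓝 x ∧ t₀ * p.derivative.eval x + q.derivative.eval x ≠ 0) :
    ∀ᶠ t in 𝓝 t₀, {x | x ∈ K ∧ t * p.eval x + q.eval x = 0}.ncard =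
      {x | x ∈ K ∧ t₀ * p.eval x + q.eval x = 0}.ncard := by
  set S := {x | x ∈ K ∧ t₀ * p.eval x + q.eval x = 0} with hS
  have hex : ∀ x : ℝ, ∃ φ : ℝ → ℝ, x ∈ S → Tendsto φ (𝓝 t₀) (𝓝 x) ∧
      ∀ᶠ v : ℝ × ℝ in 𝓝 (t₀, x), v.1 * p.eval v.2 + q.eval v.2 = 0 ↔ φ v.1 = v.2 := by
    intro x
    by_cases hx : x ∈ S
    · obtain ⟨φ, hφ⟩ := exists_tendsto_eventually_root_iff p q hx.2 (hroot x hx.1 hx.2).2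
      exact ⟨φ, fun _ => hφ⟩
    · exact ⟨id, fun h => absurd h hx⟩
  choose φ hφ using hex
  have hcover : ∀ᶠ t in 𝓝 t₀, ∀ y ∈ K, t * p.eval y + q.eval y = 0 → ∃ x ∈ S, φ x t = y := by
    refine hK.eventually_forall_of_forall_eventually fun y hy => ?_
    by_cases hy0 : t₀ * p.eval y + q.eval y = 0
    · filter_upwards [(hφ y ⟨hy, hy0⟩).2] with v hv h
      exact ⟨y, ⟨hy, hy0⟩, hv.mp h⟩
    · have hc : ContinuousAt (fun v : ℝ × ℝ => v.1 * p.eval v.2 + q.eval v.2) (t₀, y) := by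
        fun_prop
      filter_upwards [hc.eventually_ne hy0] with v hv h
      exact absurd h hv
  have hmem : ∀ᶠ t in 𝓝 t₀, ∀ x ∈ S, φ x t ∈ K ∧ t * p.eval (φ x t) + q.eval (φ x t) = 0 := by
    refine (eventually_all_finite hfin).mpr fun x hx => ?_
    have ht := (hφ x hx).1
    have htt : Tendsto (fun t => (t, φ x t)) (𝓝 t₀) (𝓝 (t₀, x)) := tendsto_id.prodMk_nhds ht
    filter_upwards [ht.eventually (hroot x hx.1 hx.2).1, htt.eventually (hφ x hx).2] with t h₁ h₂
    exact ⟨h₁, h₂.mpr rfl⟩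
  have hinj : ∀ᶠ t in 𝓝 t₀, ∀ x ∈ S, ∀ y ∈ S, φ x t = φ y t → x = y := by
    refine (eventually_all_finite hfin).mpr fun x hx => (eventually_all_finite hfin).mpr
      fun y hy => ?_
    by_cases hxy : x = y
    · exact Eventually.of_forall fun _ _ => hxy
    · filter_upwards [((hφ x hx).1.sub (hφ y hy).1).eventually_ne (sub_ne_zero.mpr hxy)] with t ht h
      exact absurd (sub_eq_zero.mpr h) ht
  filter_upwards [hcover, hmem, hinj] with t h₁ h₂ h₃
  have himg : {x | x ∈ K ∧ t * p.eval x + q.eval x = 0} = (fun x => φ x t) '' S := by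
    ext y
    constructor
    · rintro ⟨hy, h⟩
      obtain ⟨x, hx, rfl⟩ := h₁ y hy h
      exact ⟨x, hx, rfl⟩
    · rintro ⟨x, hx, rfl⟩
      exact h₂ x hx
  rw [himg, Set.InjOn.ncard_image fun x hx y hy h => h₃ x hx y hy h]

theorem eventually_abs_eval_lt_mul_pow {g : ℝ[X]} {n : ℕ} (hg : g.natDegree < n) {δ : ℝ}
    (hδ : 0 < δ) : ∀ᶠ x in atTop, |g.eval x| < δ * x ^ n := by
  have hdeg : g.degree < (X ^ n : ℝ[X]).degree := by
    rw [degree_X_pow]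
    exact lt_of_le_of_lt degree_le_natDegree (by exact_mod_cast hg)
  have h := (div_tendsto_atTop_zero_of_degree_lt g (X ^ n) hdeg).abs
  rw [abs_zero] at h
  filter_upwards [h.eventually (gt_mem_nhds hδ), eventually_gt_atTop 0] with x hx hx0
  have hpow : 0 < x ^ n := pow_pos hx0 n
  rwa [eval_pow, eval_X, abs_div, abs_of_pos hpow, div_lt_iff₀ hpow] at hx

/-- The polynomial `n g - x g'` is the numerator of the derivative of `-g / x ^ n`, and double roots
of the pencil are among its roots. -/
theorem coeff_natDegree_C_mul_sub_X_mul_derivative (g : ℝ[X]) (n : ℕ) :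
    (C (n : ℝ) * g - X * derivative g).coeff g.natDegree =
      (n - g.natDegree) * g.leadingCoeff := by
  rw [coeff_sub, coeff_C_mul, leadingCoeff]
  rcases hd : g.natDegree with _ | d
  · simp
  · rw [coeff_X_mul, coeff_derivative]
    push_cast
    ring

theorem eventually_ncard_roots_gt_eq_zero {g : ℝ[X]} (hg : 0 < g.natDegree)
    (hlc : 0 < g.leadingCoeff) (n : ℕ) :
    ∀ᶠ R in atTop, ∀ᶠ ε in 𝓝[>] (0 : ℝ),
      {x : ℝ | R < x ∧ ε * x ^ n + g.eval x = 0}.ncard = 0 := by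
  have hpos := (g.tendsto_atTop_of_leadingCoeff_nonneg (natDegree_pos_iff_degree_pos.mp hg)
    hlc.le).eventually_gt_atTop 0
  filter_upwards [eventually_forall_ge_atTop.mpr (hpos.and (eventually_gt_atTop 0))] with R hR
  filter_upwards [self_mem_nhdsWithin] with ε hε
  convert Set.ncard_empty ℝ
  rw [Set.eq_empty_iff_forall_notMem]
  rintro x ⟨hRx, hx⟩
  obtain ⟨h₁, h₂⟩ := hR x hRx.le
  have := mul_pos hε (pow_pos h₂ n)
  linarith

/-- For large `x` the equation reads `-g(x) / x ^ n = ε`. The left side is positive and strictly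
decreasing to `0`, so it takes each small value `ε > 0` exactly once. -/
theorem eventually_ncard_roots_gt_eq_one {g : ℝ[X]} (hg : 0 < g.natDegree)
    (hlc : g.leadingCoeff < 0) {n : ℕ} (hn : g.natDegree < n) :
    ∀ᶠ R in atTop, ∀ᶠ ε in 𝓝[>] (0 : ℝ),
      {x : ℝ | R < x ∧ ε * x ^ n + g.eval x = 0}.ncard = 1 := by
  have hneg := (g.tendsto_atBot_of_leadingCoeff_nonpos (natDegree_pos_iff_degree_pos.mp hg)
    hlc.le).eventually_lt_atBot 0
  set w : ℝ[X] := C (n : ℝ) * g - X * derivative g with hw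
  have hwc : w.coeff g.natDegree = (n - g.natDegree) * g.leadingCoeff :=
    coeff_natDegree_C_mul_sub_X_mul_derivative g n
  have hwlt : w.coeff g.natDegree < 0 := by
    rw [hwc]
    exact mul_neg_of_pos_of_neg (sub_pos.mpr (by exact_mod_cast hn)) hlc
  have hwd : w.natDegree = g.natDegree := by
    refine natDegree_eq_of_le_of_coeff_ne_zero ?_ hwlt.ne
    refine (natDegree_sub_le _ _).trans (max_le (natDegree_C_mul_le _ _) ?_)
    have := natDegree_derivative_le g
    exact natDegree_mul_le.trans (by rw [natDegree_X]; omega)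
  have hwneg := (w.tendsto_atBot_of_leadingCoeff_nonpos
    (natDegree_pos_iff_degree_pos.mp (hwd ▸ hg))
    (by rw [leadingCoeff, hwd]; exact hwlt.le)).eventually_lt_atBot 0
  filter_upwards 
    [eventually_forall_ge_atTop.mpr ((hneg.and hwneg).and (eventually_gt_atTop 0))] with R hR
  set h : ℝ → ℝ := fun x => -g.eval x / x ^ n with hh
  have hderiv : ∀ x ∈ Set.Ici R, HasDerivAt h (w.eval x / x ^ (n + 1)) x := by
    intro x hx
    have hx0 : x ≠ 0 := (hR x hx).2.ne'
    obtain ⟨m, rfl⟩ := Nat.exists_eq_succ_of_ne_zero (by omega : n ≠ 0)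
    refine ((g.hasDerivAt x).neg.div (hasDerivAt_pow (m + 1) x) (pow_ne_zero _ hx0)).congr_deriv ?_
    simp only [hw, Pi.neg_apply, eval_sub, eval_mul, eval_C, eval_X, Nat.succ_eq_add_one]
    rw [div_eq_div_iff (pow_ne_zero _ (pow_ne_zero _ hx0)) (pow_ne_zero _ hx0)]
    simp only [add_tsub_cancel_right]
    ring
  have hcont : ContinuousOn h (Set.Ici R) := fun x hx =>
    (hderiv x hx).continuousAt.continuousWithinAt
  have hanti : StrictAntiOn h (Set.Ici R) := by
    refine strictAntiOn_of_deriv_neg (convex_Ici R) hcont fun x hx => ?_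
    rw [interior_Ici] at hx
    have hx' : x ∈ Set.Ici R := Set.mem_Ici.mpr (le_of_lt hx)
    rw [(hderiv x hx').deriv]
    exact div_neg_of_neg_of_pos (hR x hx').1.2 (pow_pos (hR x hx').2 _)
  have hiff : ∀ x ∈ Set.Ici R, ∀ ε, ε * x ^ n + g.eval x = 0 ↔ h x = ε := by
    intro x hx ε
    rw [hh, div_eq_iff (pow_pos (hR x hx).2 n).ne']
    constructor <;> intro h <;> linarith
  have hRpos : 0 < h R :=
    div_pos (neg_pos.mpr (hR R le_rfl).1.1) (pow_pos (hR R le_rfl).2 n)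
  filter_upwards [Ioo_mem_nhdsGT hRpos] with ε hε
  obtain ⟨b, hRb, hb⟩ := ((eventually_ge_atTop R).and
    (eventually_abs_eval_lt_mul_pow hn hε.1)).exists
  have hhb : h b ≤ ε := by
    rw [hh, div_le_iff₀ (pow_pos (hR b hRb).2 n)]
    exact (neg_le_abs _).trans hb.le
  obtain ⟨x, hx, hxε⟩ := intermediate_value_Icc' hRb (hcont.mono Set.Icc_subset_Ici_self)
    ⟨hhb, hε.2.le⟩
  have hRx : R < x := lt_of_le_of_ne hx.1 fun h => by subst h; exact hε.2.ne' hxε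
  rw [Set.ncard_eq_one]
  refine ⟨x, Set.eq_singleton_iff_unique_mem.mpr ⟨⟨hRx, (hiff x hx.1 ε).mpr hxε⟩, ?_⟩⟩
  rintro y ⟨hy, hyε⟩
  exact hanti.injOn (Set.mem_Ici.mpr hy.le) hx.1 (((hiff y hy.le ε).mp hyε).trans hxε.symm)

theorem eventually_ncard_roots_gt {g : ℝ[X]} (hg : 0 < g.natDegree) {n : ℕ}
    (hn : g.natDegree < n) :
    ∀ᶠ R in atTop, ∀ᶠ ε in 𝓝[>] (0 : ℝ),
      {x : ℝ | R < x ∧ ε * x ^ n + g.eval x = 0}.ncard =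
        if g.leadingCoeff < 0 then 1 else 0 := by
  split_ifs with h
  · exact eventually_ncard_roots_gt_eq_one hg h hn
  · exact eventually_ncard_roots_gt_eq_zero hg (lt_of_le_of_ne (not_lt.mp h)
      (leadingCoeff_ne_zero.mpr (ne_zero_of_natDegree_gt hg)).symm) n

theorem finite_setOf_root {g : ℝ[X]} (hg : g ≠ 0) {n : ℕ} (hn : g.natDegree < n) (ε : ℝ) :
    {x : ℝ | ε * x ^ n + g.eval x = 0}.Finite := by
  have hne : C ε * X ^ n + g ≠ 0 := fun h => by
    have h' := congrArg (fun p : ℝ[X] => p.coeff g.natDegree) h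
    simp [coeff_X_pow, hn.ne, hg] at h'
  convert finite_setOfPred_isRoot hne using 3
  simp [IsRoot]

theorem neg_one_pow_mul_comp_neg_X_eval (g : ℝ[X]) (n : ℕ) (ε x : ℝ) :
    ε * x ^ n + (C ((-1) ^ n) * g.comp (-X)).eval x = (-1) ^ n * (ε * (-x) ^ n + g.eval (-x)) := by
  have h : ((-1 : ℝ) ^ n) * (-1) ^ n = 1 := by rw [← mul_pow]; simp
  rw [neg_pow x n]
  simp only [eval_mul, eval_C, eval_comp, eval_neg, eval_X]
  linear_combination (-(ε * x ^ n)) * h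

theorem natDegree_neg_one_pow_mul_comp_neg_X (g : ℝ[X]) (n : ℕ) :
    (C ((-1) ^ n) * g.comp (-X)).natDegree = g.natDegree := by
  rw [natDegree_C_mul (pow_ne_zero _ (by norm_num)), natDegree_comp]
  simp

theorem eventually_ncard_roots_small {g : ℝ[X]} (hg : 0 < g.natDegree) {n : ℕ}
    (hn : g.natDegree < n) (hsimple : ∀ x, g.eval x = 0 → g.derivative.eval x ≠ 0) :
    ∀ᶠ ε in 𝓝[>] (0 : ℝ), {x : ℝ | ε * x ^ n + g.eval x = 0}.ncard =
      numRealRoots g + (if g.leadingCoeff < 0 then 1 else 0) +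
        (if (-1) ^ (n - g.natDegree) * g.leadingCoeff < 0 then 1 else 0) := by
  have hg0 : g ≠ 0 := ne_zero_of_natDegree_gt hg
  -- The reflection `x ↦ -x` turns the negative tail into a positive one; the sign `(-1) ^ n` keeps
  -- the coefficient of `x ^ n` equal to `ε`.
  set g' : ℝ[X] := C ((-1) ^ n) * g.comp (-X) with hg'
  have hdeg' : g'.natDegree = g.natDegree := natDegree_neg_one_pow_mul_comp_neg_X g n
  have hlc' : g'.leadingCoeff = (-1) ^ (n - g.natDegree) * g.leadingCoeff := by
    rw [hg', leadingCoeff_mul, leadingCoeff_C, comp_neg_X_leadingCoeff_eq, ← mul_assoc]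
    congr 1
    obtain ⟨k, rfl⟩ := Nat.exists_eq_add_of_lt hn
    rw [show g.natDegree + k + 1 - g.natDegree = k + 1 by omega, ← pow_add,
      show g.natDegree + k + 1 + g.natDegree = 2 * g.natDegree + (k + 1) by omega, pow_add, pow_mul]
    simp
  have hbd₁ := eventually_forall_ge_atTop.mpr
    ((g.abs_tendsto_atTop (natDegree_pos_iff_degree_pos.mp hg)).eventually_gt_atTop 0)
  have hbd₂ := eventually_forall_ge_atTop.mpr
    ((g'.abs_tendsto_atTop (natDegree_pos_iff_degree_pos.mp (hdeg' ▸ hg))).eventually_gt_atTop 0)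
  obtain ⟨R, ⟨⟨⟨hR₁, hR₂⟩, hpos⟩, hneg⟩, hR0⟩ := ((((hbd₁.and hbd₂).and
    (eventually_ncard_roots_gt hg hn)).and
    (eventually_ncard_roots_gt (hdeg' ▸ hg) (hdeg' ▸ hn))).and (eventually_gt_atTop 0)).exists
  have hin : ∀ x, g.eval x = 0 → -R < x ∧ x < R := by
    intro x hx
    constructor
    · by_contra! h
      have h' := hR₂ (-x) (by linarith)
      rw [hg'] at h'
      simp [hx] at h'
    · by_contra! h
      simpa [hx] using hR₁ x h
  have hmid : ∀ᶠ ε in 𝓝[>] (0 : ℝ),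
      {x : ℝ | x ∈ Set.Icc (-R) R ∧ ε * x ^ n + g.eval x = 0}.ncard = numRealRoots g := by
    -- On a compact interval the perturbation is regular at `ε = 0`; only the tails see the jump in
    -- degree.
    have h := eventually_ncard_roots_eq (X ^ n) g (t₀ := 0) (isCompact_Icc (a := -R) (b := R))
      ((finite_setOf_root hg0 hn 0).subset fun x hx => by simpa using hx.2)
      (fun x _ hx => by
        have hx' : g.eval x = 0 := by simpa using hx
        exact ⟨Icc_mem_nhds (hin x hx').1 (hin x hx').2, by simpa using hsimple x hx'⟩)
    have h0 : {x : ℝ | x ∈ Set.Icc (-R) R ∧ 0 * (X ^ n : ℝ[X]).eval x + g.eval x = 0} =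
        {x | g.IsRoot x} := by
      ext x
      simp only [zero_mul, zero_add, Set.mem_ofPred_eq, IsRoot]
      exact ⟨fun h => h.2, fun h => ⟨⟨(hin x h).1.le, (hin x h).2.le⟩, h⟩⟩
    rw [h0] at h
    filter_upwards [nhdsWithin_le_nhds h] with ε hε
    simpa [numRealRoots] using hε
  filter_upwards [hmid, hpos, hneg] with ε h₁ h₂ h₃
  have hneg' : {x : ℝ | x < -R ∧ ε * x ^ n + g.eval x = 0} =
      Neg.neg '' {x : ℝ | R < x ∧ ε * x ^ n + g'.eval x = 0} := by
    ext x
    simp only [Set.image_neg_eq_neg, Set.mem_neg, Set.mem_ofPred_eq, hg',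
      neg_one_pow_mul_comp_neg_X_eval, neg_neg, mul_eq_zero, pow_eq_zero_iff', neg_eq_zero,
      one_ne_zero, false_and, false_or, lt_neg]
  have hsplit : {x : ℝ | ε * x ^ n + g.eval x = 0} =
      ({x : ℝ | x ∈ Set.Icc (-R) R ∧ ε * x ^ n + g.eval x = 0} ∪
        {x : ℝ | R < x ∧ ε * x ^ n + g.eval x = 0}) ∪
        {x : ℝ | x < -R ∧ ε * x ^ n + g.eval x = 0} := by
    ext x
    simp only [Set.mem_union, Set.mem_ofPred_eq, Set.mem_Icc]
    constructor
    · intro h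
      rcases lt_or_ge x (-R) with h' | h'
      · exact Or.inr ⟨h', h⟩
      · rcases lt_or_ge R x with h'' | h''
        · exact Or.inl (Or.inr ⟨h'', h⟩)
        · exact Or.inl (Or.inl ⟨⟨h', h''⟩, h⟩)
    · rintro ((⟨_, h⟩ | ⟨_, h⟩) | ⟨_, h⟩) <;> exact h
  have hfin := finite_setOf_root hg0 hn ε
  rw [hsplit, Set.ncard_union_eq _ ((hfin.subset fun x hx => hx.2).union
      (hfin.subset fun x hx => hx.2)) (hfin.subset fun x hx => hx.2),
    Set.ncard_union_eq _ (hfin.subset fun x hx => hx.2) (hfin.subset fun x hx => hx.2), h₁, h₂,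
    hneg', Set.ncard_image_of_injective _ neg_injective, h₃, hlc']
  · exact Set.disjoint_left.mpr fun x hx hx' => absurd hx'.1 (not_lt.mpr hx.1.2)
  · refine Set.disjoint_left.mpr fun x hx hx' => ?_
    rcases hx with hx | hx
    · exact absurd hx'.1 (not_lt.mpr hx.1.1)
    · have := hx'.1
      have := hx.1
      linarith

/-- Once `ε > ε₀ / 2`, the term `ε x ^ n` dominates `g` outside a fixed interval, which reduces the
count to the compact case. -/
theorem eventually_ncard_roots_eq_of_pos {g : ℝ[X]} (hg : 0 < g.natDegree) {n : ℕ}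
    (hn : g.natDegree < n) {ε₀ : ℝ} (hε₀ : 0 < ε₀)
    (hsimple : ∀ x, ε₀ * x ^ n + g.eval x = 0 →
      ε₀ * (X ^ n : ℝ[X]).derivative.eval x + g.derivative.eval x ≠ 0) :
    ∀ᶠ ε in 𝓝 ε₀, {x : ℝ | ε * x ^ n + g.eval x = 0}.ncard =
      {x : ℝ | ε₀ * x ^ n + g.eval x = 0}.ncard := by
  have hg0 : g ≠ 0 := ne_zero_of_natDegree_gt hg
  set g' : ℝ[X] := C ((-1) ^ n) * g.comp (-X) with hg'
  have hdeg' : g'.natDegree = g.natDegree := natDegree_neg_one_pow_mul_comp_neg_X g n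
  have key {p : ℝ[X]} {ε x : ℝ} (hx : 0 < x) (h : |p.eval x| < ε₀ / 2 * x ^ n) (hε : ε₀ / 2 < ε) :
      ε * x ^ n + p.eval x ≠ 0 := by
    have h₁ := mul_lt_mul_of_pos_right hε (pow_pos hx n)
    have h₂ := neg_abs_le (p.eval x)
    linarith
  obtain ⟨R, ⟨hR₁, hR₂⟩, hR0⟩ := (((eventually_forall_ge_atTop.mpr
    (eventually_abs_eval_lt_mul_pow hn (half_pos hε₀))).and
    (eventually_forall_ge_atTop.mpr
      (eventually_abs_eval_lt_mul_pow (hdeg' ▸ hn) (half_pos hε₀)))).and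
    (eventually_gt_atTop 0)).exists
  have hin : ∀ ε, ε₀ / 2 < ε → ∀ x, ε * x ^ n + g.eval x = 0 → -R < x ∧ x < R := by
    intro ε hε x hx
    constructor
    · by_contra! h
      refine key (by linarith) (hR₂ (-x) (by linarith)) hε ?_
      rw [hg', neg_one_pow_mul_comp_neg_X_eval, neg_neg, hx, mul_zero]
    · by_contra! h
      exact key (by linarith) (hR₁ x h) hε hx
  have hset : ∀ ε, ε₀ / 2 < ε → {x : ℝ | ε * x ^ n + g.eval x = 0} =
      {x : ℝ | x ∈ Set.Icc (-R) R ∧ ε * (X ^ n : ℝ[X]).eval x + g.eval x = 0} := by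
    intro ε hε
    ext x
    simp only [Set.mem_ofPred_eq, eval_pow, eval_X]
    exact ⟨fun h => ⟨⟨(hin ε hε x h).1.le, (hin ε hε x h).2.le⟩, h⟩, fun h => h.2⟩
  have h := eventually_ncard_roots_eq (X ^ n) g (t₀ := ε₀) (isCompact_Icc (a := -R) (b := R))
    (by rw [← hset ε₀ (by linarith)]; exact finite_setOf_root hg0 hn ε₀)
    (fun x _ hx => by
      rw [eval_pow, eval_X] at hx
      have hx' := hin ε₀ (by linarith) x hx
      exact ⟨Icc_mem_nhds hx'.1 hx'.2, hsimple x hx⟩)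
  filter_upwards [h, lt_mem_nhds (half_lt_self hε₀)] with ε h₁ h₂
  rw [hset ε h₂, hset ε₀ (by linarith), h₁]

end Pencil
end BezoutianRealRoots
namespace BezoutianRealRoots

/-! ### Zeros of `P_r` and the root count beyond the largest one. -/

section Family

open Filter Topology

variable {s : ℕ} {r : Fin (s + 1) → ℝ} {n : ℕ}

theorem natDegree_gPoly (hdeg : (gPoly r).degree = (s : WithBot ℕ)) : (gPoly r).natDegree = s :=
  natDegree_eq_of_degree_eq_some hdeg

theorem leadingCoeff_gPoly (hdeg : (gPoly r).degree = (s : WithBot ℕ)) :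
    (gPoly r).leadingCoeff = r (Fin.last s) := by
  rw [leadingCoeff, natDegree_gPoly hdeg, gPoly, finsetSum_coeff,
    Finset.sum_eq_single (Fin.last s)]
  · simp
  · intro k _ hk
    have : s ≠ (k : ℕ) := fun h => hk (Fin.ext (by simp [h]))
    rw [coeff_C_mul_X_pow, if_neg this]
  · simp

theorem fPolyAt_eq (n : ℕ) (r : Fin (s + 1) → ℝ) (ξ : ℝ) :
    fPolyAt n r ξ = X ^ n + C ξ * gPoly r := by
  have h : (evalRingHom ξ).comp C = RingHom.id ℝ := by ext; simp
  simp [fPolyAt, fPoly, Polynomial.map_map, h]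

theorem degree_C_mul_gPoly_lt (hdeg : (gPoly r).degree = (s : WithBot ℕ)) (hsn : s < n) (ξ : ℝ) :
    (C ξ * gPoly r).degree < n :=
  degree_le_natDegree.trans_lt (by
    exact_mod_cast (natDegree_C_mul_le _ _).trans_lt ((natDegree_gPoly hdeg).trans_lt hsn))

theorem monic_fPolyAt (hdeg : (gPoly r).degree = (s : WithBot ℕ)) (hsn : s < n) (ξ : ℝ) :
    (fPolyAt n r ξ).Monic := by
  rw [fPolyAt_eq]
  exact monic_X_pow_add (degree_C_mul_gPoly_lt hdeg hsn ξ)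

theorem natDegree_fPolyAt (hdeg : (gPoly r).degree = (s : WithBot ℕ)) (hsn : s < n) (ξ : ℝ) :
    (fPolyAt n r ξ).natDegree = n := by
  refine natDegree_eq_of_degree_eq_some ?_
  rw [fPolyAt_eq, degree_add_eq_left_of_degree_lt, degree_X_pow]
  rw [degree_X_pow]
  exact degree_C_mul_gPoly_lt hdeg hsn ξ

theorem eval_PPoly (n : ℕ) (r : Fin (s + 1) → ℝ) (ξ : ℝ) :
    (PPoly n r).eval ξ = (bezoutian n (fPolyAt n r ξ) (derivative (fPolyAt n r ξ))).det := by
  have h := map_det_bezoutian (evalRingHom ξ) n (fPoly n r) (derivative (fPoly n r))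
  rw [← derivative_map] at h
  exact h

theorem eval_PPoly_eq_zero_of_isRoot (hdeg : (gPoly r).degree = (s : WithBot ℕ)) (hsn : s < n)
    {ξ x : ℝ} (h : (fPolyAt n r ξ).IsRoot x) (h' : (derivative (fPolyAt n r ξ)).IsRoot x) :
    (PPoly n r).eval ξ = 0 := by
  have hd := natDegree_fPolyAt hdeg hsn ξ
  have hd' := natDegree_derivative_le (fPolyAt n r ξ)
  rw [eval_PPoly]
  exact det_bezoutian_eq_zero_of_isRoot (by omega) hd.le (by omega) h h'

theorem eval_zero_PPoly (hs : 1 ≤ s) (hdeg : (gPoly r).degree = (s : WithBot ℕ)) (hsn : s < n) :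
    (PPoly n r).eval 0 = 0 := by
  refine eval_PPoly_eq_zero_of_isRoot hdeg hsn (x := 0) ?_ ?_
  · simp [fPolyAt_eq, IsRoot, show n ≠ 0 by omega]
  · simp [fPolyAt_eq, IsRoot, derivative_X_pow, show n - 1 ≠ 0 by omega]

theorem finite_setOf_eval_PPoly_eq_zero (hs : 1 ≤ s) (hdeg : (gPoly r).degree = (s : WithBot ℕ))
    (hsn : s < n) (hsep : (gPoly r).Separable) : {a : ℝ | (PPoly n r).eval a = 0}.Finite := by
  set g := gPoly r with hg
  set w : ℝ[X] := C (n : ℝ) * g - X * derivative g with hw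
  have hgd : g.natDegree = s := natDegree_gPoly hdeg
  have hg0 : g ≠ 0 := ne_zero_of_natDegree_gt (n := 0) (by omega)
  have hw0 : w ≠ 0 := by
    intro h
    have hc := coeff_natDegree_C_mul_sub_X_mul_derivative g n
    rw [← hw, h, coeff_zero, eq_comm, mul_eq_zero, hgd] at hc
    rcases hc with hc | hc
    · exact absurd (sub_eq_zero.mp hc) (by exact_mod_cast hsn.ne')
    · exact hg0 (leadingCoeff_eq_zero.mp hc)
  refine (((rootSet_finite w ℂ).image fun z => (-z ^ n / aeval z g).re).insert 0).subset ?_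
  intro ξ hξ
  by_cases hξ0 : ξ = 0
  · exact Or.inl hξ0
  right
  have hd := natDegree_fPolyAt hdeg hsn ξ
  have hd' := natDegree_derivative_le (fPolyAt n r ξ)
  have hnco : ¬ IsCoprime (fPolyAt n r ξ) (derivative (fPolyAt n r ξ)) := fun hco =>
    det_bezoutian_ne_zero_of_isCoprime (monic_fPolyAt hdeg hsn ξ) hd (by omega) hco
      (by rw [← eval_PPoly]; exact hξ)
  rw [isCoprime_iff_aeval_ne_zero_of_isAlgClosed ℝ ℂ] at hnco
  push Not at hnco
  obtain ⟨z, hz, hz'⟩ := hnco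
  have hsepz := (isCoprime_iff_aeval_ne_zero_of_isAlgClosed ℝ ℂ _ _).mp hsep z
  rw [fPolyAt_eq, ← hg] at hz hz'
  simp only [map_add, map_mul, map_pow, aeval_X, aeval_C, derivative_mul,
    derivative_C, derivative_X_pow, zero_mul, zero_add, Complex.coe_algebraMap, map_natCast] at hz hz'
  obtain ⟨m, rfl⟩ : ∃ m, n = m + 2 := ⟨n - 2, by omega⟩
  simp only [show m + 2 - 1 = m + 1 by omega] at hz'
  have hξc : (ξ : ℂ) ≠ 0 := by exact_mod_cast hξ0
  -- If `g(z) = 0`, then `z = 0`; as `n ≥ 2`, the derivative equation gives `g'(0) = 0`,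
  -- contradicting separability.
  have hgz : aeval z g ≠ 0 := by
    intro h
    rw [h, mul_zero, add_zero] at hz
    have hz0 : z = 0 := eq_zero_of_pow_eq_zero hz
    rw [hz0, zero_pow (by omega), mul_zero, zero_add, mul_eq_zero] at hz'
    rcases hsepz with h' | h'
    · exact h' h
    · exact h' (hz0 ▸ hz'.resolve_left hξc)
  refine ⟨z, ?_, ?_⟩
  · rw [mem_rootSet]
    refine ⟨hw0, ?_⟩
    -- The combination `n f - x f'` cancels `x ^ n` and leaves `ξ w`.
    have : (ξ : ℂ) * aeval z w = 0 := by
      simp only [hw, map_sub, map_mul, aeval_X, map_natCast]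
      linear_combination ((m + 2 : ℕ) : ℂ) * hz - z * hz'
    exact (mul_eq_zero.mp this).resolve_left hξc
  · have : -z ^ (m + 2) / aeval z g = (ξ : ℂ) := by
      rw [div_eq_iff hgz]
      linear_combination -hz
    simp [this]

theorem numRealRoots_fPolyAt {ξ : ℝ} (hξ : ξ ≠ 0) :
    numRealRoots (fPolyAt n r ξ) = {x : ℝ | ξ⁻¹ * x ^ n + (gPoly r).eval x = 0}.ncard := by
  rw [numRealRoots]
  congr 1
  ext x
  simp only [Set.mem_ofPred_eq, IsRoot, fPolyAt_eq, eval_add, eval_pow, eval_X, eval_mul, eval_C]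
  rw [← mul_right_inj' hξ (b := ξ⁻¹ * x ^ n + _), mul_add, mul_inv_cancel_left₀ hξ, mul_zero]

theorem numRealRoots_fPolyAt_of_forall_gt (hs : 1 ≤ s)
    (hdeg : (gPoly r).degree = (s : WithBot ℕ)) (hsn : s < n) (hsep : (gPoly r).Separable)
    {α : ℝ} (hα : 0 ≤ α) (hP : ∀ ξ, α < ξ → (PPoly n r).eval ξ ≠ 0) {ξ : ℝ} (hξ : α < ξ) :
    numRealRoots (fPolyAt n r ξ) = numRealRoots (gPoly r) +
      (if r (Fin.last s) < 0 then 1 else 0) +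
      (if (-1) ^ (n - s) * r (Fin.last s) < 0 then 1 else 0) := by
  have hgd : (gPoly r).natDegree = s := natDegree_gPoly hdeg
  set N : ℝ → ℕ := fun ε => {x : ℝ | ε * x ^ n + (gPoly r).eval x = 0}.ncard with hN
  -- This is the interval of inverses of `ξ > α`, written without division so that `α = 0` is
  -- allowed.
  set E : Set ℝ := {ε | 0 < ε ∧ α * ε < 1} with hE
  have hEconn : IsPreconnected E := by
    refine isPreconnected_iff_ordConnected.mpr ⟨fun a ha b hb x hx => ⟨ha.1.trans_le hx.1, ?_⟩⟩
    exact (mul_le_mul_of_nonneg_left hx.2 hα).trans_lt hb.2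
  -- Continuity into the discrete space `ℕ` on a preconnected set means constancy.
  have hcont : ContinuousOn N E := by
    intro ε hε
    have hαε : α < ε⁻¹ := by rw [← one_div, lt_div_iff₀ hε.1]; exact hε.2
    have h := eventually_ncard_roots_eq_of_pos (g := gPoly r) (by omega) (by omega : _ < n) hε.1
      fun x hx hx' => by
        have h₁ : x ^ n + ε⁻¹ * (gPoly r).eval x = 0 := by
          have := congrArg (ε⁻¹ * ·) hx
          simpa [mul_add, inv_mul_cancel_left₀ hε.1.ne'] using this
        have h₂ : (X ^ n : ℝ[X]).derivative.eval x + ε⁻¹ * (gPoly r).derivative.eval x = 0 := by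
          have := congrArg (ε⁻¹ * ·) hx'
          simpa only [mul_add, inv_mul_cancel_left₀ hε.1.ne', mul_zero] using this
        refine hP ε⁻¹ hαε (eval_PPoly_eq_zero_of_isRoot hdeg hsn (x := x) ?_ ?_)
        · simpa [fPolyAt_eq, IsRoot] using h₁
        · simpa [fPolyAt_eq, IsRoot] using h₂
    exact (continuousAt_const.congr (h.mono fun _ h => h.symm)).continuousWithinAt
  have hsmall := eventually_ncard_roots_small (g := gPoly r) (by omega) (by omega : _ < n)
    fun x hx hx' => by
      have h := aeval_ne_zero_of_isCoprime hsep x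
      simp only [coe_aeval_eq_eval, hx, hx', ne_eq, not_true, or_self] at h
  have hEmem : ∀ᶠ ε in 𝓝[>] (0 : ℝ), ε ∈ E := by
    have hc : ContinuousAt (fun ε : ℝ => α * ε) 0 := by fun_prop
    have h1 : ∀ᶠ ε in 𝓝 (0 : ℝ), α * ε < 1 :=
      hc.tendsto.eventually (gt_mem_nhds (by simp))
    filter_upwards [self_mem_nhdsWithin, nhdsWithin_le_nhds h1] with ε h₁ h₂
    exact ⟨h₁, h₂⟩
  obtain ⟨ε, hε, hεE⟩ := (hsmall.and hEmem).exists
  have hξ0 : 0 < ξ := hα.trans_lt hξ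
  have hξE : ξ⁻¹ ∈ E := ⟨inv_pos.mpr hξ0, by rwa [← div_eq_mul_inv, div_lt_one hξ0]⟩
  rw [numRealRoots_fPolyAt hξ0.ne', show Set.ncard _ = N ξ⁻¹ from rfl,
    hEconn.constant hcont hξE hεE, ← leadingCoeff_gPoly hdeg]
  rw [hgd] at hε
  exact hε

end Family

end BezoutianRealRoots

open BezoutianRealRoots
theorem theorem5p2 (n s : ℕ) (hs : 1 ≤ s) (hsn : s < n) (r : Fin (s + 1) → ℝ)
    (hdeg : (gPoly r).degree = (s : WithBot ℕ)) (hsep : (gPoly r).Separable)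
    (γ : ℕ) (hγ : numRealRoots (gPoly r) = γ) :
    ∃ α : ℝ, IsGreatest {a : ℝ | (PPoly n r).eval a = 0} α ∧
      ∀ ξ : ℝ, α < ξ →
        (Odd (n - s) → numRealRoots (fPolyAt n r ξ) = γ + 1) ∧
        (Even (n - s) → 0 < r (Fin.last s) → numRealRoots (fPolyAt n r ξ) = γ) ∧
        (Even (n - s) → r (Fin.last s) < 0 → numRealRoots (fPolyAt n r ξ) = γ + 2) := by
  obtain ⟨α, hα, hmax⟩ := Set.exists_max_image _ id
    (finite_setOf_eval_PPoly_eq_zero hs hdeg hsn hsep) ⟨0, eval_zero_PPoly hs hdeg hsn⟩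
  have hgreatest : IsGreatest {a : ℝ | (PPoly n r).eval a = 0} α := ⟨hα, fun a ha => hmax a ha⟩
  refine ⟨α, hgreatest, fun ξ hξ => ?_⟩
  -- That `0` is a zero of `P_r` also supplies `0 ≤ α`.
  have hcount := numRealRoots_fPolyAt_of_forall_gt hs hdeg hsn hsep
    (hgreatest.2 (eval_zero_PPoly hs hdeg hsn))
    (fun ξ hξ h => absurd (hgreatest.2 h) (not_le.mpr hξ)) hξ
  have hlast : r (Fin.last s) ≠ 0 := by
    rw [← leadingCoeff_gPoly hdeg, leadingCoeff_ne_zero]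
    rintro h
    simp [h] at hdeg
  rw [hcount, hγ]
  refine ⟨fun hodd => ?_, fun heven hpos => ?_, fun heven hneg => ?_⟩
  · rw [hodd.neg_one_pow]
    rcases lt_or_gt_of_ne hlast with h | h
    · rw [if_pos h, if_neg (by linarith)]
    · rw [if_neg h.not_gt, if_pos (by linarith)]
  · rw [heven.neg_one_pow, one_mul, if_neg hpos.not_gt, add_zero, add_zero]
  · rw [heven.neg_one_pow, one_mul, if_pos hneg]
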